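/- Let $0<q<1$ and let each of $Y_1,Y_2$ be one of two quantum spaces $\widetilde X$ (quantum principal homogeneous space) or $\widetilde\Xi$ (quantum cone), defined as follows. $\mathrm{Pol}(Y)_q$ is the unital $\mathbb C$-algebra with generators $t_{11},t_{12},t_{21},t_{22}$ and relations $t_{11}t_{12}=qt_{12}t_{11}$, $t_{21}t_{22}=qt_{22}t_{21}$, $t_{11}t_{21}=qt_{21}t_{11}$, $t_{12}t_{22}=qt_{22}t_{12}$, $t_{12}t_{21}=t_{21}t_{12}$, $t_{11}t_{22}-t_{22}t_{11}=(q-q^{-1})t_{12}t_{21}$, and $t_{11}t_{22}-qt_{12}t_{21}=1$ for $Y=\widetilde X$, resp. $t_{11}t_{22}-qt_{12}t_{21}=0$ for $Y=\widetilde\Xi$, with the involution $t_{11}^*=-t_{22}$, $t_{12}^*=-qt_{21}$. Put $x=t_{12}t_{12}^*$. The space of distributions $D(Y)_q'\supset \mathrm{Pol}(Y)_q$ is the space of formal series $$f=\sum_{i_1j_1=i_2j_2=0}t_{11}^{i_1}t_{12}^{i_2}\,\psi_{i_1i_2j_1j_2}(x)\,t_{12}^{*j_2}t_{11}^{*j_1}\qquad(i_1,i_2,j_1,j_2\in\mathbb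 Z_{\ge0})$$ whose coefficients are arbitrary complex functions on $q^{-2\mathbb Z_{\ge 0}}$ (for $\widetilde X$), resp. on $q^{2\mathbb Z}$ (for $\widetilde\Xi$), with the topology of pointwise convergence of the coefficients. The space $D(Y)_q$ of finite functions consists of the $f$ for which only finitely many values of the coefficients are nonzero. The involution of $D(Y)'_q$ and the product $D(Y)_q'\times D(Y)_q\to D(Y)_q'$ are transferred by continuity from $\mathrm{Pol}(Y)_q$, and $$\int_{Y_q} f\,d\nu=(1-q^2)\sum_{m}\psi_{0000}(q^{-2m})\,q^{-2m},$$ where $m$ runs over $\mathbb Z_{\ge0}$ for $\widetilde X$ and over $\mathbb Z$ for $\widetilde\Xi$; this is used for those $f$ for which $\psi_{0000}$ has finite support. Let $D(Y_1\times Y_2)_q'$ be the corresponding completion of $\mathrm{Pol}(Y_1\times Y_2)_q=\mathrm{Pol}(Y_1)_q^{\rm op}\otimes\mathrm{Pol}(Y_2)_q$, that is, the space of formal series in tensor products of the above monomials whose coefficients are arbitrary functions of two variables on the product of the two progressions. For $K\in D(Y_1\times Y_2)'_q$ and $f\in D(Y_2)_q$ let $\int_{Y_{2q}}\{K\cdot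 1\otimes f\}\,d\nu_2\in D(Y_1)'_q$ be the partial integral in the second factor. Then there is a unique antilinear map $\#:D(Y_1\times Y_2)_q'\to D(Y_1\times Y_2)_q'$ such that for all $K\in D(Y_1\times Y_2)_q'$ and $f\in D(Y_2)_q$ $$\int_{Y_{2q}}\{K^\#\cdot 1\otimes f\}\,d\nu_2=\Bigl(\int_{Y_{2q}}\{K\cdot 1\otimes f^*\}\,d\nu_2\Bigr)^*,$$ and, writing $t_{ij}$ for the kernel $t_{ij}\otimes1$ and $\tau_{ij}$ for the kernel $1\otimes t_{ij}$, it satisfies $$t_{11}^\#=-t_{22},\qquad t_{21}^\#=-q^{-1}t_{12},\qquad \tau_{11}^\#=-q^{-2}\tau_{22},\qquad \tau_{21}^\#=-q^{-1}\tau_{12}.$$ -/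

import Mathlib

open scoped TensorProduct

noncomputable section

namespace QKernel

/-- The quantum principal homogeneous space `X` (written `X` with a tilde in print) and its
asymptotic quantum cone `Xi`. -/
inductive Space
  | X
  | Xi

/-- The parameter `q`, `0 < q < 1`, as a complex number. -/
def cq (q : Set.Ioo (0 : ℝ) 1) : ℂ := ((q : ℝ) : ℂ)

/-- The four generators `t₁₁, t₁₂, t₂₁, t₂₂`. -/
inductive Gen
  | t11
  | t12
  | t21
  | t22

/-- The right hand side of the "determinant" relation `t₁₁ t₂₂ - q t₁₂ t₂₁ = 1` for `X` and
`t₁₁ t₂₂ - q t₁₂ t₂₁ = 0` for the cone. -/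
def detVal : Space → ℂ
  | .X => 1
  | .Xi => 0

/-- The defining relations of the algebra of polynomials on `X` (that is, of `ℂ[SL₂]_q`) and on the
cone. -/
inductive Rel (q : Set.Ioo (0 : ℝ) 1) (Y : Space) :
    FreeAlgebra ℂ Gen → FreeAlgebra ℂ Gen → Prop
  | r1 : Rel q Y (FreeAlgebra.ι ℂ Gen.t11 * FreeAlgebra.ι ℂ Gen.t12)
      (cq q • (FreeAlgebra.ι ℂ Gen.t12 * FreeAlgebra.ι ℂ Gen.t11))
  | r2 : Rel q Y (FreeAlgebra.ι ℂ Gen.t21 * FreeAlgebra.ι ℂ Gen.t22)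
      (cq q • (FreeAlgebra.ι ℂ Gen.t22 * FreeAlgebra.ι ℂ Gen.t21))
  | r3 : Rel q Y (FreeAlgebra.ι ℂ Gen.t11 * FreeAlgebra.ι ℂ Gen.t21)
      (cq q • (FreeAlgebra.ι ℂ Gen.t21 * FreeAlgebra.ι ℂ Gen.t11))
  | r4 : Rel q Y (FreeAlgebra.ι ℂ Gen.t12 * FreeAlgebra.ι ℂ Gen.t22)
      (cq q • (FreeAlgebra.ι ℂ Gen.t22 * FreeAlgebra.ι ℂ Gen.t12))
  | r5 : Rel q Y (FreeAlgebra.ι ℂ Gen.t12 * FreeAlgebra.ι ℂ Gen.t21)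
      (FreeAlgebra.ι ℂ Gen.t21 * FreeAlgebra.ι ℂ Gen.t12)
  | r6 : Rel q Y (FreeAlgebra.ι ℂ Gen.t11 * FreeAlgebra.ι ℂ Gen.t22
        - FreeAlgebra.ι ℂ Gen.t22 * FreeAlgebra.ι ℂ Gen.t11)
      ((cq q - (cq q)⁻¹) • (FreeAlgebra.ι ℂ Gen.t12 * FreeAlgebra.ι ℂ Gen.t21))
  | r7 : Rel q Y (FreeAlgebra.ι ℂ Gen.t11 * FreeAlgebra.ι ℂ Gen.t22
        - cq q • (FreeAlgebra.ι ℂ Gen.t12 * FreeAlgebra.ι ℂ Gen.t21))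
      (algebraMap ℂ (FreeAlgebra ℂ Gen) (detVal Y))

/-- The algebra `Pol(Y)_q`, by generators and relations. -/
abbrev Pol (q : Set.Ioo (0 : ℝ) 1) (Y : Space) : Type := RingQuot (Rel q Y)

/-- The generators of `Pol(Y)_q`. -/
def gen (q : Set.Ioo (0 : ℝ) 1) (Y : Space) (g : Gen) : Pol q Y :=
  RingQuot.mkAlgHom ℂ (Rel q Y) (FreeAlgebra.ι ℂ g)

/-- The element `t₁₁^* = -t₂₂` of `Pol(Y)_q`. -/
def t11s (q : Set.Ioo (0 : ℝ) 1) (Y : Space) : Pol q Y := -gen q Y .t22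

/-- The element `t₁₂^* = -q t₂₁` of `Pol(Y)_q`. -/
def t12s (q : Set.Ioo (0 : ℝ) 1) (Y : Space) : Pol q Y := -(cq q • gen q Y .t21)

/-- The geometric progression on which the coefficients live: `m ∈ Grid Y` stands for the point
`x = q^(-2m)`, where `m = 0, 1, 2, …` for `X` and `m` is an arbitrary integer for the cone. -/
def Grid : Space → Set ℤ
  | .X => Set.Ici 0
  | .Xi => Set.univ

/-- Indices `((a, b), m)`. The pair `(a, b) ∈ ℤ²` encodes the quadruple `(i₁, i₂, j₁, j₂)` of
nonnegative integers with `i₁ j₁ = i₂ j₂ = 0` through `a = i₁ - j₁`, `b = i₂ - j₂`,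
that is, `i₁ = a.toNat`, `j₁ = (-a).toNat`, `i₂ = b.toNat`, `j₂ = (-b).toNat`. -/
abbrev Idx (Y : Space) : Type := (ℤ × ℤ) × Grid Y

/-- The space `D(Y)'_q` of distributions: formal series
`∑ t₁₁^i₁ t₁₂^i₂ ψ_{i₁ i₂ j₁ j₂}(x) t₁₂^{* j₂} t₁₁^{* j₁}`, `x = t₁₂ t₁₂^*`, whose coefficients
are arbitrary functions on the progression. The value of `F` at `((a, b), m)` is
`ψ_{i₁ i₂ j₁ j₂}(q^(-2m))`. -/
abbrev Dist (Y : Space) : Type := Idx Y → ℂ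

/-- A finite function on `Y`: only finitely many values of the coefficients are nonzero. -/
def IsFin {Y : Space} (f : Dist Y) : Prop := (Function.support f).Finite

/-- The coefficient `ψ_{ab}` of `F` at `x = q^(-2m)`, continued by zero off the progression. -/
def val {Y : Space} (F : Dist Y) (a b m : ℤ) : ℂ :=
  open Classical in if h : m ∈ Grid Y then F ((a, b), ⟨m, h⟩) else 0

lemma cq_ne_zero (q : Set.Ioo (0 : ℝ) 1) : cq q ≠ 0 := by
  simpa [cq] using q.2.1.ne'

/-- Left multiplication by `t₁₁`. It uses
`t₁₁ t₁₂ = q t₁₂ t₁₁`, `t₁₁ t₁₂^* = q t₁₂^* t₁₁`, `t₁₁ ψ(x) = ψ(q² x) t₁₁` and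
`t₁₁ t₁₁^* = x - detVal Y`. -/
def A11 (q : Set.Ioo (0 : ℝ) 1) (Y : Space) : Module.End ℂ (Dist Y) where
  toFun F := fun ((a, b), m) =>
    if 0 < a then val F (a - 1) b m
    else cq q ^ |b| * (cq q ^ (-2 * (m : ℤ)) - detVal Y) * val F (a - 1) b (m - 1)
  map_add' F G := by
    ext ⟨⟨a, b⟩, m⟩
    simp only [val, Pi.add_apply]
    split_ifs <;> ring
  map_smul' c F := by
    ext ⟨⟨a, b⟩, m⟩
    simp only [val, Pi.smul_apply, smul_eq_mul, RingHom.id_apply]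
    split_ifs <;> ring

/-- Left multiplication by `t₁₁^*`. It uses
`t₁₁^* t₁₁ = q⁻² x - detVal Y`, `x t₁₁ = q⁻² t₁₁ x`, `t₁₁^* t₁₂ = q⁻¹ t₁₂ t₁₁^*`,
`t₁₁^* t₁₂^* = q⁻¹ t₁₂^* t₁₁^*` and `t₁₁^* ψ(x) = ψ(q⁻² x) t₁₁^*`. -/
def A11s (q : Set.Ioo (0 : ℝ) 1) (Y : Space) : Module.End ℂ (Dist Y) where
  toFun F := fun ((a, b), m) =>
    if 0 ≤ a then (cq q ^ (-2 * (a + 1 + m)) - detVal Y) * val F (a + 1) b m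
    else cq q ^ (-|b|) * val F (a + 1) b (m + 1)
  map_add' F G := by
    ext ⟨⟨a, b⟩, m⟩
    simp only [val, Pi.add_apply]
    split_ifs <;> ring
  map_smul' c F := by
    ext ⟨⟨a, b⟩, m⟩
    simp only [val, Pi.smul_apply, smul_eq_mul, RingHom.id_apply]
    split_ifs <;> ring

/-- Left multiplication by `t₁₂`. It uses `t₁₂ t₁₁ = q⁻¹ t₁₁ t₁₂` and `t₁₂ t₁₂^* = x`. -/
def A12 (q : Set.Ioo (0 : ℝ) 1) (Y : Space) : Module.End ℂ (Dist Y) where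
  toFun F := fun ((a, b), m) =>
    cq q ^ (-max a 0) * (if 0 < b then 1 else cq q ^ (-2 * (m : ℤ))) * val F a (b - 1) m
  map_add' F G := by
    ext ⟨⟨a, b⟩, m⟩
    simp only [val, Pi.add_apply]
    split_ifs <;> ring
  map_smul' c F := by
    ext ⟨⟨a, b⟩, m⟩
    simp only [val, Pi.smul_apply, smul_eq_mul, RingHom.id_apply]
    split_ifs <;> ring

/-- Left multiplication by `t₁₂^*`. It uses `t₁₂^* t₁₁ = q⁻¹ t₁₁ t₁₂^*` and
`t₁₂^* t₁₂ = x`. -/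
def A12s (q : Set.Ioo (0 : ℝ) 1) (Y : Space) : Module.End ℂ (Dist Y) where
  toFun F := fun ((a, b), m) =>
    cq q ^ (-max a 0) * (if b < 0 then 1 else cq q ^ (-2 * (m : ℤ))) * val F a (b + 1) m
  map_add' F G := by
    ext ⟨⟨a, b⟩, m⟩
    simp only [val, Pi.add_apply]
    split_ifs <;> ring
  map_smul' c F := by
    ext ⟨⟨a, b⟩, m⟩
    simp only [val, Pi.smul_apply, smul_eq_mul, RingHom.id_apply]
    split_ifs <;> ring

/-- Left multiplication by `ψ(x)`, `ψ` a function on the progression. It uses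
`ψ(x) t₁₁^i = t₁₁^i ψ(q^(-2i) x)`. -/
def Afun {Y : Space} (ψ : Grid Y → ℂ) : Module.End ℂ (Dist Y) where
  toFun F := fun ((a, b), m) =>
    (open Classical in if h : (m : ℤ) + max a 0 ∈ Grid Y then ψ ⟨m + max a 0, h⟩ else 0)
      * F ((a, b), m)
  map_add' F G := by
    ext ⟨⟨a, b⟩, m⟩
    simp only [Pi.add_apply]
    ring
  map_smul' c F := by
    ext ⟨⟨a, b⟩, m⟩
    simp only [Pi.smul_apply, smul_eq_mul, RingHom.id_apply]
    ring

/-- Left multiplication by the generators, with `t₂₁ = -q⁻¹ t₁₂^*`, `t₂₂ = -t₁₁^*`. -/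
def genAct (q : Set.Ioo (0 : ℝ) 1) (Y : Space) : Gen → Module.End ℂ (Dist Y)
  | .t11 => A11 q Y
  | .t12 => A12 q Y
  | .t21 => -((cq q)⁻¹ • A12s q Y)
  | .t22 => -A11s q Y

lemma grid_add_one {Y : Space} {m : ℤ} (h : m ∈ Grid Y) : m + 1 ∈ Grid Y := by
  cases Y <;> simp_all [Grid]; omega

lemma grid_sub_one {Y : Space} {m : ℤ} (q : Set.Ioo (0 : ℝ) 1) (h : m ∈ Grid Y)
    (h' : m - 1 ∉ Grid Y) : cq q ^ (-2 * m) - detVal Y = 0 := by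
  cases Y
  · simp only [Grid, Set.mem_Ici] at h h'
    obtain rfl : m = 0 := by omega
    simp [detVal]
  · simp [Grid] at h'

lemma A11_apply (q : Set.Ioo (0 : ℝ) 1) {Y : Space} (F : Dist Y) (a b : ℤ) (m : Grid Y) :
    A11 q Y F ((a, b), m) = if 0 < a then val F (a - 1) b m
      else cq q ^ |b| * (cq q ^ (-2 * (m : ℤ)) - detVal Y) * val F (a - 1) b (m - 1) := rfl

lemma A11s_apply (q : Set.Ioo (0 : ℝ) 1) {Y : Space} (F : Dist Y) (a b : ℤ) (m : Grid Y) :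
    A11s q Y F ((a, b), m) =
      if 0 ≤ a then (cq q ^ (-2 * (a + 1 + m)) - detVal Y) * val F (a + 1) b m
      else cq q ^ (-|b|) * val F (a + 1) b (m + 1) := rfl

lemma A12_apply (q : Set.Ioo (0 : ℝ) 1) {Y : Space} (F : Dist Y) (a b : ℤ) (m : Grid Y) :
    A12 q Y F ((a, b), m) = cq q ^ (-max a 0) *
      (if 0 < b then 1 else cq q ^ (-2 * (m : ℤ))) * val F a (b - 1) m := rfl

lemma A12s_apply (q : Set.Ioo (0 : ℝ) 1) {Y : Space} (F : Dist Y) (a b : ℤ) (m : Grid Y) :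
    A12s q Y F ((a, b), m) = cq q ^ (-max a 0) *
      (if b < 0 then 1 else cq q ^ (-2 * (m : ℤ))) * val F a (b + 1) m := rfl

lemma val_mem {Y : Space} (F : Dist Y) (a b : ℤ) {m : ℤ} (h : m ∈ Grid Y) :
    val F a b m = F ((a, b), ⟨m, h⟩) := by simp [val, h]

lemma val_notMem {Y : Space} (F : Dist Y) (a b : ℤ) {m : ℤ} (h : m ∉ Grid Y) :
    val F a b m = 0 := by simp [val, h]

lemma rel_11_12 (q : Set.Ioo (0 : ℝ) 1) (Y : Space) :
    A11 q Y * A12 q Y = cq q • (A12 q Y * A11 q Y) := by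
  have hq := cq_ne_zero q
  ext F ⟨⟨a, b⟩, ⟨m, hm⟩⟩
  simp only [Module.End.mul_apply, LinearMap.smul_apply, Pi.smul_apply, smul_eq_mul]
  rcases lt_or_ge 0 a with ha | ha
  · simp only [A11_apply, A12_apply, val_mem, hm, ha, if_true, max_eq_left ha.le,
      max_eq_left (show (0 : ℤ) ≤ a - 1 by omega)]
    rw [show -a = -(a - 1) - 1 by ring, zpow_sub_one₀ hq]
    field_simp
  · by_cases hm' : m - 1 ∈ Grid Y
    · simp only [A11_apply, A12_apply, val_mem, hm, hm', ha.not_gt, if_false, max_eq_right ha,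
        max_eq_right (show a - 1 ≤ 0 by omega), neg_zero, zpow_zero, one_mul]
      rw [show -2 * (m - 1) = -2 * m + 2 by ring, zpow_add₀ hq]
      rcases lt_or_ge 0 b with hb | hb
      · rw [if_pos hb, if_pos hb, abs_of_pos hb, abs_of_nonneg (show (0 : ℤ) ≤ b - 1 by omega),
          zpow_sub_one₀ hq]
        field_simp
      · rw [if_neg hb.not_gt, if_neg hb.not_gt, abs_of_nonpos hb,
          abs_of_nonpos (show b - 1 ≤ 0 by omega), show -(b - 1) = -b + 1 by ring,
          zpow_add_one₀ hq]
        simp only [zpow_ofNat]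
        ring
    · simp [A11_apply, A12_apply, val_mem, val_notMem, hm, hm', ha.not_gt]

lemma rel_11_12s (q : Set.Ioo (0 : ℝ) 1) (Y : Space) :
    A11 q Y * A12s q Y = cq q • (A12s q Y * A11 q Y) := by
  have hq := cq_ne_zero q
  ext F ⟨⟨a, b⟩, ⟨m, hm⟩⟩
  simp only [Module.End.mul_apply, LinearMap.smul_apply, Pi.smul_apply, smul_eq_mul]
  rcases lt_or_ge 0 a with ha | ha
  · simp only [A11_apply, A12s_apply, val_mem, hm, ha, if_true, max_eq_left ha.le,
      max_eq_left (show (0 : ℤ) ≤ a - 1 by omega)]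
    rw [show -a = -(a - 1) - 1 by ring, zpow_sub_one₀ hq]
    field_simp
  · by_cases hm' : m - 1 ∈ Grid Y
    · simp only [A11_apply, A12s_apply, val_mem, hm, hm', ha.not_gt, if_false, max_eq_right ha,
        max_eq_right (show a - 1 ≤ 0 by omega), neg_zero, zpow_zero, one_mul]
      rw [show -2 * (m - 1) = -2 * m + 2 by ring, zpow_add₀ hq]
      rcases lt_or_ge b 0 with hb | hb
      · rw [if_pos hb, if_pos hb, abs_of_neg hb, abs_of_nonpos (show b + 1 ≤ 0 by omega),
          show -b = -(b + 1) + 1 by ring, zpow_add_one₀ hq]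
        ring
      · rw [if_neg hb.not_gt, if_neg hb.not_gt, abs_of_nonneg hb,
          abs_of_nonneg (show 0 ≤ b + 1 by omega), zpow_add_one₀ hq]
        simp only [zpow_ofNat]
        ring
    · simp [A11_apply, A12s_apply, val_mem, val_notMem, hm, hm', ha.not_gt]

lemma rel_12_11s (q : Set.Ioo (0 : ℝ) 1) (Y : Space) :
    A12 q Y * A11s q Y = cq q • (A11s q Y * A12 q Y) := by
  have hq := cq_ne_zero q
  ext F ⟨⟨a, b⟩, ⟨m, hm⟩⟩
  have hm' := grid_add_one hm
  simp only [Module.End.mul_apply, LinearMap.smul_apply, Pi.smul_apply, smul_eq_mul]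
  rcases le_or_gt 0 a with ha | ha
  · simp only [A11s_apply, A12_apply, val_mem, hm, ha, if_true, max_eq_left ha,
      max_eq_left (show (0 : ℤ) ≤ a + 1 by omega)]
    rw [show -(a + 1) = -a - 1 by ring, zpow_sub_one₀ hq]
    field_simp
  · simp only [A11s_apply, A12_apply, val_mem, hm, hm', ha.not_ge, if_false, max_eq_right ha.le,
      max_eq_right (show a + 1 ≤ 0 by omega), neg_zero, zpow_zero, one_mul]
    rw [show -2 * (m + 1) = -2 * m - 1 - 1 by ring, zpow_sub_one₀ hq, zpow_sub_one₀ hq]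
    rcases lt_or_ge 0 b with hb | hb
    · rw [if_pos hb, if_pos hb, abs_of_pos hb, abs_of_nonneg (show (0 : ℤ) ≤ b - 1 by omega),
        show -b = -(b - 1) - 1 by ring, zpow_sub_one₀ hq]
      field_simp
    · rw [if_neg hb.not_gt, if_neg hb.not_gt, abs_of_nonpos hb,
        abs_of_nonpos (show b - 1 ≤ 0 by omega), neg_neg, neg_neg, zpow_sub_one₀ hq]
      field_simp

lemma rel_12s_11s (q : Set.Ioo (0 : ℝ) 1) (Y : Space) :
    A12s q Y * A11s q Y = cq q • (A11s q Y * A12s q Y) := by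
  have hq := cq_ne_zero q
  ext F ⟨⟨a, b⟩, ⟨m, hm⟩⟩
  have hm' := grid_add_one hm
  simp only [Module.End.mul_apply, LinearMap.smul_apply, Pi.smul_apply, smul_eq_mul]
  rcases le_or_gt 0 a with ha | ha
  · simp only [A11s_apply, A12s_apply, val_mem, hm, ha, if_true, max_eq_left ha,
      max_eq_left (show (0 : ℤ) ≤ a + 1 by omega)]
    rw [show -(a + 1) = -a - 1 by ring, zpow_sub_one₀ hq]
    field_simp
  · simp only [A11s_apply, A12s_apply, val_mem, hm, hm', ha.not_ge, if_false, max_eq_right ha.le,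
      max_eq_right (show a + 1 ≤ 0 by omega), neg_zero, zpow_zero, one_mul]
    rw [show -2 * (m + 1) = -2 * m - 1 - 1 by ring, zpow_sub_one₀ hq, zpow_sub_one₀ hq]
    rcases lt_or_ge b 0 with hb | hb
    · rw [if_pos hb, if_pos hb, abs_of_neg hb, abs_of_nonpos (show b + 1 ≤ 0 by omega),
        neg_neg, neg_neg, zpow_add_one₀ hq]
      field_simp
    · rw [if_neg hb.not_gt, if_neg hb.not_gt, abs_of_nonneg hb,
        abs_of_nonneg (show 0 ≤ b + 1 by omega), show -(b + 1) = -b - 1 by ring,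
        zpow_sub_one₀ hq]
      field_simp

lemma A12_A12s_apply (q : Set.Ioo (0 : ℝ) 1) {Y : Space} (F : Dist Y) (a b : ℤ) (m : Grid Y) :
    (A12 q Y * A12s q Y) F ((a, b), m) = cq q ^ (-2 * (max a 0 + m)) * F ((a, b), m) := by
  have hq := cq_ne_zero q
  obtain ⟨m, hm⟩ := m
  simp only [Module.End.mul_apply, A12s_apply, A12_apply, val_mem, hm, sub_add_cancel]
  rw [show -2 * (max a 0 + m) = -max a 0 + -max a 0 + -2 * m by ring, zpow_add₀ hq, zpow_add₀ hq]
  rcases lt_or_ge 0 b with hb | hb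
  · rw [if_pos hb, if_neg (by omega)]; ring
  · rw [if_neg hb.not_gt, if_pos (by omega)]; ring

lemma rel_12_12s (q : Set.Ioo (0 : ℝ) 1) (Y : Space) :
    A12 q Y * A12s q Y = A12s q Y * A12 q Y := by
  have hq := cq_ne_zero q
  ext F ⟨⟨a, b⟩, ⟨m, hm⟩⟩
  simp only [Module.End.mul_apply, A12s_apply, A12_apply, val_mem, hm, sub_add_cancel,
    add_sub_cancel_right]
  rcases lt_trichotomy b 0 with hb | rfl | hb
  · rw [if_neg (by omega), if_pos (by omega), if_pos (by omega), if_neg (by omega)]; ring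
  · simp
  · rw [if_pos (by omega), if_neg (by omega), if_neg (by omega), if_pos (by omega)]; ring

lemma rel_11_11s (q : Set.Ioo (0 : ℝ) 1) (Y : Space) :
    A11 q Y * A11s q Y = A12 q Y * A12s q Y - algebraMap ℂ _ (detVal Y) := by
  have hq := cq_ne_zero q
  ext F ⟨⟨a, b⟩, ⟨m, hm⟩⟩
  rw [LinearMap.sub_apply, Pi.sub_apply, A12_A12s_apply, Module.algebraMap_end_apply,
    Pi.smul_apply, smul_eq_mul, Module.End.mul_apply]
  rcases lt_or_ge 0 a with ha | ha
  · simp only [A11_apply, A11s_apply, val_mem, hm, ha, if_true, max_eq_left ha.le,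
      if_pos (show (0 : ℤ) ≤ a - 1 by omega), sub_add_cancel]
    ring
  · by_cases hm' : m - 1 ∈ Grid Y
    · simp only [A11_apply, A11s_apply, val_mem, hm, hm', ha.not_gt, if_false, max_eq_right ha,
        if_neg (show ¬ (0 : ℤ) ≤ a - 1 by omega), sub_add_cancel, zero_add]
      rw [zpow_neg]
      field_simp
    · simp only [A11_apply, val_notMem _ _ _ hm', ha.not_gt, if_false, max_eq_right ha, zero_add,
        ← sub_mul, grid_sub_one q hm hm']
      simp

lemma rel_11s_11 (q : Set.Ioo (0 : ℝ) 1) (Y : Space) :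
    A11s q Y * A11 q Y =
      (cq q)⁻¹ ^ 2 • (A12 q Y * A12s q Y) - algebraMap ℂ _ (detVal Y) := by
  have hq := cq_ne_zero q
  ext F ⟨⟨a, b⟩, ⟨m, hm⟩⟩
  have hm' := grid_add_one hm
  rw [LinearMap.sub_apply, Pi.sub_apply, LinearMap.smul_apply, Pi.smul_apply, A12_A12s_apply,
    Module.algebraMap_end_apply, Pi.smul_apply, smul_eq_mul, smul_eq_mul, Module.End.mul_apply]
  rcases le_or_gt 0 a with ha | ha
  · simp only [A11_apply, A11s_apply, val_mem, hm, ha, if_true, max_eq_left ha,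
      if_pos (show (0 : ℤ) < a + 1 by omega), add_sub_cancel_right]
    rw [show -2 * (a + 1 + m) = -2 * (a + m) - 1 - 1 by ring, zpow_sub_one₀ hq, zpow_sub_one₀ hq]
    ring
  · simp only [A11_apply, A11s_apply, val_mem, hm, hm', ha.not_ge, if_false, max_eq_right ha.le,
      if_neg (show ¬ (0 : ℤ) < a + 1 by omega), add_sub_cancel_right, zero_add]
    rw [show -2 * (m + 1) = -2 * m - 1 - 1 by ring, zpow_sub_one₀ hq, zpow_sub_one₀ hq, zpow_neg]
    field_simp

lemma lift_rel {R : Type*} [Ring R] [Algebra ℂ R] (q : Set.Ioo (0 : ℝ) 1) (Y : Space)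
    (T B Bs Ts : R) (f : Gen → R) (f11 : f .t11 = T) (f12 : f .t12 = B)
    (f21 : f .t21 = -((cq q)⁻¹ • Bs)) (f22 : f .t22 = -Ts)
    (h1 : T * B = cq q • (B * T)) (h2 : T * Bs = cq q • (Bs * T))
    (h3 : B * Ts = cq q • (Ts * B)) (h4 : Bs * Ts = cq q • (Ts * Bs)) (h5 : B * Bs = Bs * B)
    (h6 : T * Ts = B * Bs - algebraMap ℂ R (detVal Y))
    (h7 : Ts * T = (cq q)⁻¹ ^ 2 • (B * Bs) - algebraMap ℂ R (detVal Y)) :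
    ∀ ⦃x y⦄, Rel q Y x y → FreeAlgebra.lift ℂ f x = FreeAlgebra.lift ℂ f y := by
  have hq := cq_ne_zero q
  intro x y h
  cases h <;> simp only [map_mul, map_smul, map_sub, AlgHom.commutes, FreeAlgebra.lift_ι_apply,
    f11, f12, f21, f22, neg_mul, mul_neg, neg_neg, smul_mul_assoc, mul_smul_comm, smul_neg]
  · exact h1
  · rw [h4, smul_comm]
  · rw [h2, smul_comm]
  · rw [h3]
  · rw [h5]
  · rw [h6, h7]
    (match_scalars <;> field_simp); all_goals ring
  · rw [h6]
    (match_scalars <;> field_simp); all_goals ring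

/-- The left action of `Pol(Y)_q` on the formal series, with `t₂₁ = -q⁻¹ t₁₂^*` and
`t₂₂ = -t₁₁^*`. -/
def act (q : Set.Ioo (0 : ℝ) 1) (Y : Space) : Pol q Y →ₐ[ℂ] Module.End ℂ (Dist Y) :=
  RingQuot.liftAlgHom ℂ ⟨FreeAlgebra.lift ℂ (genAct q Y),
    lift_rel q Y (A11 q Y) (A12 q Y) (A12s q Y) (A11s q Y) (genAct q Y) rfl rfl rfl rfl
      (rel_11_12 q Y) (rel_11_12s q Y) (rel_12_11s q Y) (rel_12s_11s q Y) (rel_12_12s q Y)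
      (rel_11_11s q Y) (rel_11s_11 q Y)⟩

/-- The series `1`: `ψ_{00} = 1` and all the other coefficients vanish. -/
def oneDist (Y : Space) : Dist Y := fun i => if i.1 = (0, 0) then 1 else 0

/-- The embedding of `Pol(Y)_q` into `D(Y)'_q`: the expansion of `p = p · 1`. -/
def emb (q : Set.Ioo (0 : ℝ) 1) (Y : Space) : Pol q Y →ₗ[ℂ] Dist Y :=
  (LinearMap.applyₗ (oneDist Y)) ∘ₗ (act q Y).toLinearMap

lemma emb_apply (q : Set.Ioo (0 : ℝ) 1) (Y : Space) (g : Gen) :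
    emb q Y (gen q Y g) = genAct q Y g (oneDist Y) := by
  simp [emb, act, gen]

/-- The series of `t₁₁`. -/
lemma emb_t11 (q : Set.Ioo (0 : ℝ) 1) (Y : Space) :
    emb q Y (gen q Y .t11) = fun i => if i.1 = (1, 0) then 1 else 0 := by
  rw [emb_apply]
  ext ⟨⟨a, b⟩, ⟨m, hm⟩⟩
  by_cases ha : 0 < a
  · simp [genAct, A11_apply, val_mem, hm, ha, oneDist, sub_eq_zero]
  · have h1 : a ≠ 1 := by omega
    have h2 : a - 1 ≠ 0 := by omega
    simp [genAct, A11_apply, val, ha, oneDist, h1, h2]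

/-- The series of `t₁₂`. -/
lemma emb_t12 (q : Set.Ioo (0 : ℝ) 1) (Y : Space) :
    emb q Y (gen q Y .t12) = fun i => if i.1 = (0, 1) then 1 else 0 := by
  rw [emb_apply]
  ext ⟨⟨a, b⟩, ⟨m, hm⟩⟩
  by_cases ha : a = 0
  · by_cases hb : b = 1
    · simp [genAct, A12_apply, val_mem, hm, ha, oneDist, hb]
    · have : b - 1 ≠ 0 := by omega
      simp [genAct, A12_apply, val_mem, hm, ha, oneDist, hb, this]
  · simp [genAct, A12_apply, val_mem, hm, ha, oneDist]

/-- The series of `t₂₁ = -q⁻¹ t₁₂^*`. -/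
lemma emb_t21 (q : Set.Ioo (0 : ℝ) 1) (Y : Space) :
    emb q Y (gen q Y .t21) = fun i => if i.1 = (0, -1) then -(cq q)⁻¹ else 0 := by
  rw [emb_apply]
  ext ⟨⟨a, b⟩, ⟨m, hm⟩⟩
  by_cases ha : a = 0
  · by_cases hb : b = -1
    · simp [genAct, A12s_apply, val_mem, hm, ha, oneDist, hb]
    · have : b + 1 ≠ 0 := by omega
      simp [genAct, A12s_apply, val_mem, hm, ha, oneDist, hb, this]
  · simp [genAct, A12s_apply, val_mem, hm, ha, oneDist]

/-- The series of `t₂₂ = -t₁₁^*`. -/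
lemma emb_t22 (q : Set.Ioo (0 : ℝ) 1) (Y : Space) :
    emb q Y (gen q Y .t22) = fun i => if i.1 = (-1, 0) then -1 else 0 := by
  rw [emb_apply]
  ext ⟨⟨a, b⟩, ⟨m, hm⟩⟩
  have hm' := grid_add_one hm
  by_cases ha : 0 ≤ a
  · have h1 : a ≠ -1 := by omega
    have h2 : a + 1 ≠ 0 := by omega
    simp [genAct, A11s_apply, val_mem, hm, ha, oneDist, h1, h2]
  · by_cases h1 : a = -1
    · by_cases hb : b = 0 <;>
        simp [genAct, A11s_apply, val_mem, hm', oneDist, h1, hb]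
    · have h2 : a + 1 ≠ 0 := by omega
      simp [genAct, A11s_apply, val_mem, hm', ha, oneDist, h1, h2]

/-- The product `F · f` of a distribution and a finite function: the terms
`t₁₁^i₁ t₁₂^i₂ ψ_{i₁ i₂ j₁ j₂}(x) t₁₂^{* j₂} t₁₁^{* j₁}` of the series `F` act on `f` by left
multiplication, and the results are added (for finite `f`, each coefficient of the sum receives
finitely many nonzero contributions). -/
def mulFin (q : Set.Ioo (0 : ℝ) 1) {Y : Space} (F f : Dist Y) : Dist Y := fun i =>
  ∑ᶠ d : ℤ × ℤ,
    act q Y (gen q Y .t11 ^ d.1.toNat * gen q Y .t12 ^ d.2.toNat)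
      (Afun (fun m => F (d, m))
        (act q Y (t12s q Y ^ (-d.2).toNat * t11s q Y ^ (-d.1).toNat) f)) i

/-- The involution of `D(Y)'_q`: the antilinear antimultiplicative map which sends
`t₁₁^i₁ t₁₂^i₂ ψ(x) t₁₂^{* j₂} t₁₁^{* j₁}` to
`t₁₁^j₁ t₁₂^j₂ (conj ψ)(x) t₁₂^{* i₂} t₁₁^{* i₁}`, termwise. -/
def conjDist {Y : Space} (F : Dist Y) : Dist Y := fun i =>
  starRingEnd ℂ (F ((-i.1.1, -i.1.2), i.2))

/-- The involution satisfies `t₁₁^* = -t₂₂`. -/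
lemma conjDist_emb_t11 (q : Set.Ioo (0 : ℝ) 1) (Y : Space) :
    conjDist (emb q Y (gen q Y .t11)) = emb q Y (t11s q Y) := by
  rw [t11s, map_neg, emb_t22, emb_t11]
  ext ⟨⟨a, b⟩, m⟩
  by_cases h : a = -1 ∧ b = 0
  · simp [conjDist, h]
  · have h' : ¬ (-a = 1 ∧ b = 0) := by omega
    simp [conjDist, h, h']

/-- The involution satisfies `t₁₂^* = -q t₂₁`. -/
lemma conjDist_emb_t12 (q : Set.Ioo (0 : ℝ) 1) (Y : Space) :
    conjDist (emb q Y (gen q Y .t12)) = emb q Y (t12s q Y) := by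
  rw [t12s, map_neg, map_smul, emb_t21, emb_t12]
  have hq := cq_ne_zero q
  ext ⟨⟨a, b⟩, m⟩
  by_cases h : a = 0 ∧ b = -1
  · simp [conjDist, h, hq]
  · have h' : ¬ (a = 0 ∧ -b = 1) := by omega
    simp [conjDist, h, h']

/-- The invariant integral `(1 - q²) ∑ ψ_{00}(q^(-2m)) q^(-2m)`, for `F` such that `ψ_{00}`
has finite support. -/
def integral (q : Set.Ioo (0 : ℝ) 1) {Y : Space} (F : Dist Y) : ℂ :=
  (1 - cq q ^ 2) * ∑ᶠ m : Grid Y, F ((0, 0), m) * cq q ^ (-2 * (m : ℤ))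

/-- The space `D(Y₁ × Y₂)'_q` of distributions on the product: formal series whose coefficients
are functions on the product of the two progressions. -/
abbrev Dist2 (Y₁ Y₂ : Space) : Type := Idx Y₁ → Idx Y₂ → ℂ

/-- `Pol(Y₁ × Y₂)_q`, the tensor product of the opposite of `Pol(Y₁)_q` and `Pol(Y₂)_q`. -/
abbrev Pol2 (q : Set.Ioo (0 : ℝ) 1) (Y₁ Y₂ : Space) : Type := (Pol q Y₁)ᵐᵒᵖ ⊗[ℂ] Pol q Y₂

/-- `F₁ ⊗ F₂` as a distribution on the product. -/
def extProd (Y₁ Y₂ : Space) : Dist Y₁ →ₗ[ℂ] Dist Y₂ →ₗ[ℂ] Dist2 Y₁ Y₂ :=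
  LinearMap.mk₂ ℂ (fun F₁ F₂ i₁ i₂ => F₁ i₁ * F₂ i₂)
    (fun _ _ _ => by ext; simp [add_mul]) (fun _ _ _ => by ext; simp [mul_assoc])
    (fun _ _ _ => by ext; simp [mul_add]) (fun _ _ _ => by ext; simp [mul_left_comm])

/-- The embedding of `Pol(Y₁ × Y₂)_q` into `D(Y₁ × Y₂)'_q`. -/
def emb2 (q : Set.Ioo (0 : ℝ) 1) (Y₁ Y₂ : Space) : Pol2 q Y₁ Y₂ →ₗ[ℂ] Dist2 Y₁ Y₂ :=
  TensorProduct.lift ((extProd Y₁ Y₂).compl₁₂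
    (emb q Y₁ ∘ₗ (MulOpposite.opLinearEquiv ℂ).symm.toLinearMap) (emb q Y₂))

/-- The kernel `t_{ij} = t_{ij} ⊗ 1`. -/
def t (q : Set.Ioo (0 : ℝ) 1) (Y₁ Y₂ : Space) (g : Gen) : Pol2 q Y₁ Y₂ :=
  MulOpposite.op (gen q Y₁ g) ⊗ₜ[ℂ] 1

/-- The kernel `τ_{ij} = 1 ⊗ t_{ij}`. -/
def τ (q : Set.Ioo (0 : ℝ) 1) (Y₁ Y₂ : Space) (g : Gen) : Pol2 q Y₁ Y₂ :=
  1 ⊗ₜ[ℂ] gen q Y₂ g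

/-- The partial integral `∫ {K · 1 ⊗ f} dν₂ ∈ D(Y₁)'_q` of a kernel `K ∈ D(Y₁ × Y₂)'_q` against
a finite function `f` on `Y₂`. -/
def partialInt (q : Set.Ioo (0 : ℝ) 1) {Y₁ Y₂ : Space} (K : Dist2 Y₁ Y₂) (f : Dist Y₂) :
    Dist Y₁ := fun i => integral q (mulFin q (K i) f)

/-- The property that determines the antilinear map `#` of the space of kernels: for all kernels
`K` and finite functions `f`, `∫ {K^# · 1 ⊗ f} dν₂ = (∫ {K · 1 ⊗ f^*} dν₂)^*`. -/
def IsSharp (q : Set.Ioo (0 : ℝ) 1) {Y₁ Y₂ : Space}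
    (s : Dist2 Y₁ Y₂ →ₛₗ[starRingEnd ℂ] Dist2 Y₁ Y₂) : Prop :=
  ∀ (K : Dist2 Y₁ Y₂) (f : Dist Y₂), IsFin f →
    partialInt q (s K) f = conjDist (partialInt q K (conjDist f))

end QKernel

end

noncomputable section

namespace QKernel

open Finset

variable (q : Set.Ioo (0 : ℝ) 1) {Y : Space}

/-! The pairing `∫ F · f dν` is diagonal in the monomial coefficients. Only the coefficient of `f`
in bidegree `(-a, -b)` at `x = q^(-2m)` meets the coefficient of `F` in bidegree `(a, b)` at the
same point. They pair with weight `w(a, b, m) q^(-2(m + a⁺))`, where `a⁺ = max a 0` and `w` is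
`pairWeight` (`integral_mulFin`). The factor `w` is real, depends only on `|a|`, `|b|` and `m`, and
never vanishes on the progression. Nonvanishing makes the pairing nondegenerate, so `K^#` is
determined by its integrals. Reality and symmetry mean that only `q^(-2a⁺)` distinguishes a bidegree
from its opposite. Since `a⁺ - (-a)⁺ = a`, the defining identity of `#` holds exactly when the
coefficients are conjugated, moved to the opposite bidegrees in both variables, and multiplied by
`q^(2a)`, with `a` the first degree in the second variable. On generators this extra factor is
visible only for `τ₁₁`, whose adjoint has `a = -1`; this gives the `q^(-2)`. -/

/-! ### Coefficients of left multiplication by powers of the generators. -/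

lemma act_gen (Y : Space) (g : Gen) : act q Y (gen q Y g) = genAct q Y g := by
  simp [act, gen]

lemma act_t11s (Y : Space) : act q Y (t11s q Y) = A11s q Y := by
  simp [t11s, act_gen, genAct]

lemma act_t12s (Y : Space) : act q Y (t12s q Y) = A12s q Y := by
  simp [t12s, act_gen, genAct, cq_ne_zero q]

/-- Off the progression both sides vanish, because the progression is closed under `m ↦ m + 1`.
Allowing every integer `m` lets the inductions below run without membership conditions. -/
lemma val_A11 (F : Dist Y) {a : ℤ} (ha : a ≤ 0) (m : ℤ) :
    val (A11 q Y F) a 0 m =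
      (cq q ^ (-2 * m) - detVal Y) * val F (a - 1) 0 (m - 1) := by
  by_cases hm : m ∈ Grid Y
  · simp [val_mem _ _ _ hm, A11_apply, ha.not_gt]
  · have hm' : m - 1 ∉ Grid Y := fun h => hm (by simpa using grid_add_one h)
    rw [val_notMem _ _ _ hm, val_notMem _ _ _ hm', mul_zero]

lemma val_A11s (F : Dist Y) {a : ℤ} (ha : 0 ≤ a) (b m : ℤ) :
    val (A11s q Y F) a b m =
      (cq q ^ (-2 * (a + 1 + m)) - detVal Y) * val F (a + 1) b m := by
  by_cases hm : m ∈ Grid Y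
  · rw [val_mem _ _ _ hm, A11s_apply, if_pos ha]
  · simp [val_notMem _ _ _ hm]

lemma val_A12 (F : Dist Y) {a b : ℤ} (ha : a ≤ 0) (hb : b ≤ 0) (m : ℤ) :
    val (A12 q Y F) a b m = cq q ^ (-2 * m) * val F a (b - 1) m := by
  by_cases hm : m ∈ Grid Y
  · simp [val_mem _ _ _ hm, A12_apply, hb.not_gt, ha]
  · simp [val_notMem _ _ _ hm]

lemma val_A12s (F : Dist Y) {a b : ℤ} (ha : a ≤ 0) (hb : 0 ≤ b) (m : ℤ) :
    val (A12s q Y F) a b m = cq q ^ (-2 * m) * val F a (b + 1) m := by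
  by_cases hm : m ∈ Grid Y
  · simp [val_mem _ _ _ hm, A12s_apply, hb.not_gt, ha]
  · simp [val_notMem _ _ _ hm]

lemma val_Afun (F G : Dist Y) {a : ℤ} (ha : a ≤ 0) (b : ℤ) (d : ℤ × ℤ) (m : ℤ) :
    val (Afun (fun m => F (d, m)) G) a b m = val F d.1 d.2 m * val G a b m := by
  by_cases hm : m ∈ Grid Y
  · simp [val_mem _ _ _ hm, Afun, hm, ha]
  · simp [val_notMem _ _ _ hm]

/-- Each `t₁₁` cancels one `t₁₁^*` through `t₁₁ t₁₁^* = x - detVal Y` and moves the point one step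
along the progression. -/
lemma val_A11_pow (F : Dist Y) (i : ℕ) {a : ℤ} (ha : a ≤ 0) (m : ℤ) :
    val ((A11 q Y ^ i) F) a 0 (m + i) =
      (∏ k ∈ range i, (cq q ^ (-2 * (m + k + 1)) - detVal Y)) * val F (a - i) 0 m := by
  induction i generalizing a with
  | zero => simp
  | succ i ih =>
    rw [pow_succ', Module.End.mul_apply, val_A11 q _ ha,
      show m + ((i + 1 : ℕ) : ℤ) - 1 = m + i by push_cast; ring, ih (by omega),
      prod_range_succ, show a - ((i + 1 : ℕ) : ℤ) = a - 1 - i by push_cast; ring,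
      show m + ((i + 1 : ℕ) : ℤ) = m + i + 1 by push_cast; ring]
    ring

/-- Here `t₁₁^*` cancels `t₁₁` without moving the point, yet the product is the one in
`val_A11_pow`. This coincidence makes `pairWeight` symmetric under `d ↦ -d`. -/
lemma val_A11s_pow (F : Dist Y) (i : ℕ) (b m : ℤ) :
    val ((A11s q Y ^ i) F) 0 b m =
      (∏ k ∈ range i, (cq q ^ (-2 * (m + k + 1)) - detVal Y)) * val F i b m := by
  induction i generalizing F with
  | zero => simp
  | succ i ih =>
    rw [pow_succ, Module.End.mul_apply, ih, val_A11s q _ (by omega), prod_range_succ,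
      show (i : ℤ) + 1 + m = m + i + 1 by ring]
    push_cast
    ring

lemma val_A12_pow (F : Dist Y) (j : ℕ) {a : ℤ} (ha : a ≤ 0) (m : ℤ) :
    val ((A12 q Y ^ j) F) a 0 m = (cq q ^ (-2 * m)) ^ j * val F a (-j) m := by
  induction j generalizing F with
  | zero => simp
  | succ j ih =>
    rw [pow_succ, Module.End.mul_apply, ih, val_A12 q _ ha (by omega), pow_succ,
      show -(j : ℤ) - 1 = -((j + 1 : ℕ) : ℤ) by push_cast; ring]
    ring

lemma val_A12s_pow (F : Dist Y) (j : ℕ) {a : ℤ} (ha : a ≤ 0) (m : ℤ) :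
    val ((A12s q Y ^ j) F) a 0 m = (cq q ^ (-2 * m)) ^ j * val F a j m := by
  induction j generalizing F with
  | zero => simp
  | succ j ih =>
    rw [pow_succ, Module.End.mul_apply, ih, val_A12s q _ ha (by omega), pow_succ]
    push_cast
    ring

/-! ### The pairing weight and the degree-zero part of a product. -/

/-- The factor with which the monomials of bidegrees `(a, b)` and `(-a, -b)` pair at
`x = q^(-2m)`, up to the weight of the invariant integral. -/
def pairWeight (Y : Space) (d : ℤ × ℤ) (m : ℤ) : ℂ :=
  (∏ k ∈ range d.1.natAbs, (cq q ^ (-2 * (m + k + 1)) - detVal Y)) *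
    (cq q ^ (-2 * m)) ^ d.2.natAbs

lemma pairWeight_neg (Y : Space) (d : ℤ × ℤ) (m : ℤ) :
    pairWeight q Y (-d) m = pairWeight q Y d m := by
  simp [pairWeight]

lemma conj_cq : starRingEnd ℂ (cq q) = cq q := Complex.conj_ofReal _

lemma conj_pairWeight (Y : Space) (d : ℤ × ℤ) (m : ℤ) :
    starRingEnd ℂ (pairWeight q Y d m) = pairWeight q Y d m := by
  have h : starRingEnd ℂ (detVal Y) = detVal Y := by cases Y <;> simp [detVal]
  simp only [pairWeight, map_mul, map_prod, map_sub, map_pow, map_zpow₀, conj_cq, h]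

lemma pairWeight_ne_zero (d : ℤ × ℤ) {m : ℤ} (hm : m ∈ Grid Y) : pairWeight q Y d m ≠ 0 := by
  have hq := cq_ne_zero q
  refine mul_ne_zero (prod_ne_zero_iff.2 fun k _ => ?_) (pow_ne_zero _ (zpow_ne_zero _ hq))
  cases Y
  · have hm : 0 ≤ m := hm
    -- The shift by one matters: at the endpoint `m = 0` of the progression, `q^(-2m) - 1` itself is
    -- zero.
    have h : (q : ℝ) ^ (-2 * (m + k + 1)) ≠ 1 :=
      (one_lt_zpow_of_neg₀ q.2.1 q.2.2 (by omega)).ne'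
    simp only [detVal, sub_ne_zero, cq]
    exact_mod_cast h
  · simpa [detVal] using zpow_ne_zero _ hq

/-- The term of degree `d` of the product `F · f`. -/
def mulTerm (F f : Dist Y) (d : ℤ × ℤ) : Dist Y :=
  act q Y (gen q Y .t11 ^ d.1.toNat * gen q Y .t12 ^ d.2.toNat)
    (Afun (fun m => F (d, m))
      (act q Y (t12s q Y ^ (-d.2).toNat * t11s q Y ^ (-d.1).toNat) f))

lemma val_middle (F G : Dist Y) (d : ℤ × ℤ) {a : ℤ} (ha : a ≤ 0) (m : ℤ) :
    val ((A12 q Y ^ d.2.toNat) (Afun (fun m => F (d, m)) ((A12s q Y ^ (-d.2).toNat) G))) a 0 m =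
      (cq q ^ (-2 * m)) ^ d.2.natAbs * val F d.1 d.2 m * val G a (-d.2) m := by
  obtain ⟨d, b⟩ := d
  -- Of the powers of `t₁₂` and `t₁₂^*` at most one is nontrivial, according to the sign of `b`.
  obtain ⟨n, rfl | rfl⟩ := b.eq_nat_or_neg
  · simp [val_A12_pow q _ _ ha, val_Afun _ _ ha, mul_assoc]
  · simp [val_A12s_pow q _ _ ha, val_Afun _ _ ha, mul_left_comm, mul_assoc]

lemma val_mulTerm (F f : Dist Y) (d : ℤ × ℤ) (m : ℤ) :
    val (mulTerm q F f d) 0 0 (m + d.1.toNat) =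
      pairWeight q Y d m * val F d.1 d.2 m * val f (-d.1) (-d.2) m := by
  have h : mulTerm q F f d = (A11 q Y ^ d.1.toNat) ((A12 q Y ^ d.2.toNat)
      (Afun (fun m => F (d, m)) ((A12s q Y ^ (-d.2).toNat) ((A11s q Y ^ (-d.1).toNat) f)))) := by
    simp [mulTerm, act_gen, act_t11s, act_t12s, genAct]
  rw [h, val_A11_pow q _ _ le_rfl, val_middle q _ _ _ (by omega), pairWeight]
  obtain ⟨a, b⟩ := d
  obtain ⟨n, rfl | rfl⟩ := a.eq_nat_or_neg
  · simp
    ring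
  · simp [val_A11s_pow]
    ring

/-! ### The integral of a product as a diagonal sum. -/

/-- The point at which the contribution of the coefficient at `i` appears in the coefficient of
degree zero of a product. -/
def shiftIdx (i : Idx Y) : Grid Y × (ℤ × ℤ) :=
  (⟨(i.2 : ℤ) + i.1.1.toNat, by
    obtain ⟨-, m, hm⟩ := i
    cases Y
    · exact add_nonneg (show 0 ≤ m from hm) (by positivity)
    · trivial⟩, i.1)

lemma shiftIdx_injective : Function.Injective (shiftIdx (Y := Y)) := by
  rintro ⟨d, m, hm⟩ ⟨d', m', hm'⟩ h
  simp only [shiftIdx, Prod.mk.injEq, Subtype.mk.injEq] at h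
  obtain ⟨h, rfl⟩ := h
  simp only [Prod.mk.injEq, Subtype.mk.injEq, true_and]
  omega

lemma mulTerm_shiftIdx (F f : Dist Y) (i : Idx Y) :
    mulTerm q F f (shiftIdx i).2 ((0, 0), (shiftIdx i).1) =
      pairWeight q Y i.1 i.2 * F i * f (-i.1, i.2) := by
  obtain ⟨d, m, hm⟩ := i
  have h := val_mulTerm q F f d m
  rw [val_mem F _ _ hm, val_mem f _ _ hm] at h
  exact (val_mem _ 0 0 (shiftIdx (⟨d, m, hm⟩ : Idx Y)).1.2).symm.trans h

/-- Outside the range of `shiftIdx` the source point `n - a⁺` lies off the progression, where `F` is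
read as zero. -/
lemma mulTerm_eq_zero (F f : Dist Y) {p : Grid Y × (ℤ × ℤ)}
    (hp : p ∉ Set.range (shiftIdx (Y := Y))) : mulTerm q F f p.2 ((0, 0), p.1) = 0 := by
  obtain ⟨⟨n, hn⟩, d⟩ := p
  have hm : n - d.1.toNat ∉ Grid Y := fun h => hp ⟨(d, ⟨_, h⟩), by simp [shiftIdx]⟩
  have h := val_mulTerm q F f d (n - d.1.toNat)
  rwa [val_notMem _ _ _ hm, mul_zero, zero_mul, sub_add_cancel, val_mem _ _ _ hn] at h

lemma integral_mulFin (F : Dist Y) {f : Dist Y} (hf : IsFin f) :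
    integral q (mulFin q F f) = (1 - cq q ^ 2) * ∑ᶠ i : Idx Y,
      pairWeight q Y i.1 i.2 * F i * f (-i.1, i.2) * cq q ^ (-2 * ((i.2 : ℤ) + i.1.1.toNat)) := by
  set g : Grid Y × (ℤ × ℤ) → ℂ := fun p =>
    mulTerm q F f p.2 ((0, 0), p.1) * cq q ^ (-2 * (p.1 : ℤ)) with hg
  have hsupp : Function.support g ⊆ Set.range shiftIdx := fun p hp => by
    by_contra h
    exact hp (by simp [hg, mulTerm_eq_zero q F f h])
  -- Finiteness of `f` is used here. Without it `∑ᶠ` could take its default value zero, and the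
  -- iterated sum could not be merged into one over pairs.
  have hfin : (Function.support g).Finite := by
    refine ((hf.image fun i : Idx Y => ((-i.1, i.2) : Idx Y)).image shiftIdx).subset fun p hp => ?_
    obtain ⟨i, rfl⟩ := hsupp hp
    refine ⟨i, ⟨(-i.1, i.2), fun h => hp ?_, by simp⟩, rfl⟩
    simp only [hg]
    rw [mulTerm_shiftIdx, h, mul_zero, zero_mul]
  have h1 : ∀ m : Grid Y, mulFin q F f ((0, 0), m) * cq q ^ (-2 * (m : ℤ)) =
      ∑ᶠ d : ℤ × ℤ, g (m, d) := fun m => finsum_mul _ _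
  -- The sum over pairs is cut down to the range of the injection `shiftIdx` and then reindexed by
  -- the coefficients of `F`.
  rw [integral, finsum_congr h1, ← finsum_curry g hfin, ← finsum_mem_univ,
    ← finsum_mem_inter_support, Set.univ_inter, ← Set.inter_eq_right.2 hsupp,
    finsum_mem_inter_support, finsum_mem_range shiftIdx_injective]
  congr 1
  refine finsum_congr fun i => ?_
  simp only [hg]
  rw [mulTerm_shiftIdx]
  rfl

/-! ### Existence of the map `#`. -/

/-- Index of the adjoint monomial. -/
def starIdx (i : Idx Y) : Idx Y := (-i.1, i.2)

lemma starIdx_starIdx (i : Idx Y) : starIdx (starIdx i) = i := by simp [starIdx]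

lemma conjDist_apply (F : Dist Y) (i : Idx Y) :
    conjDist F i = starRingEnd ℂ (F (starIdx i)) := rfl

lemma isFin_conjDist {f : Dist Y} (hf : IsFin f) : IsFin (conjDist f) := by
  refine (hf.image starIdx).subset fun i hi => ⟨starIdx i, fun h => hi ?_, starIdx_starIdx i⟩
  rw [conjDist_apply, h, map_zero]

/-- The involution `#` of the space of kernels. -/
def sharp (Y₁ Y₂ : Space) : Dist2 Y₁ Y₂ →ₛₗ[starRingEnd ℂ] Dist2 Y₁ Y₂ where
  toFun K := fun i j => cq q ^ (2 * j.1.1) * starRingEnd ℂ (K (starIdx i) (starIdx j))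
  map_add' K L := by
    ext i j
    simp only [Pi.add_apply, map_add, mul_add]
  map_smul' c K := by
    ext i j
    simp only [Pi.smul_apply, smul_eq_mul, map_mul, mul_left_comm]

lemma sharp_apply (Y₁ Y₂ : Space) (K : Dist2 Y₁ Y₂) (i : Idx Y₁) (j : Idx Y₂) :
    sharp q Y₁ Y₂ K i j = cq q ^ (2 * j.1.1) * starRingEnd ℂ (K (starIdx i) (starIdx j)) := rfl

/-- Conjugation is an additive bijection, so no finiteness of the support is needed. -/
lemma map_finsum_conj {ι : Type*} (g : ι → ℂ) :
    starRingEnd ℂ (∑ᶠ i, g i) = ∑ᶠ i, starRingEnd ℂ (g i) :=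
  AddEquiv.map_finsum (starRingAut (R := ℂ)).toAddEquiv g

lemma isSharp_sharp (Y₁ Y₂ : Space) : IsSharp q (sharp q Y₁ Y₂) := by
  intro K f hf
  ext i
  rw [conjDist_apply, partialInt, partialInt, integral_mulFin q _ hf,
    integral_mulFin q _ (isFin_conjDist hf), map_mul, map_finsum_conj, map_sub, map_pow, conj_cq,
    map_one]
  congr 1
  -- Passing to adjoint monomials matches the two diagonal sums term by term.
  refine finsum_eq_of_bijective starIdx
    (Function.Involutive.bijective starIdx_starIdx) fun j => ?_
  simp only [map_mul, conj_pairWeight, map_zpow₀, conj_cq, sharp_apply, conjDist_apply,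
    Complex.conj_conj]
  obtain ⟨⟨a, b⟩, m, hm⟩ := j
  simp only [starIdx, pairWeight_neg, neg_neg, Prod.fst_neg]
  -- The identity `(-a)⁺ = a⁺ - a` accounts for the factor `q^(2a)` in `sharp`.
  have h : cq q ^ (-2 * (m + (-a).toNat)) = cq q ^ (2 * a) * cq q ^ (-2 * (m + a.toNat)) := by
    rw [← zpow_add₀ (cq_ne_zero q)]
    congr 1
    omega
  rw [h]
  ring

/-! ### Nondegeneracy of the pairing and uniqueness. -/

/-- A delta function at the adjoint index isolates a single coefficient of `F`, up to a nonzero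
factor. -/
lemma integral_mulFin_single (F : Dist Y) (i : Idx Y) :
    integral q (mulFin q F (Pi.single (starIdx i) 1)) = (1 - cq q ^ 2) *
      (pairWeight q Y i.1 i.2 * F i * cq q ^ (-2 * ((i.2 : ℤ) + i.1.1.toNat))) := by
  classical
  rw [integral_mulFin q F ((Set.finite_singleton (starIdx i)).subset
    (Pi.support_single_subset)), finsum_eq_single _ i]
  · simp [starIdx]
  · intro j hj
    have : ((-j.1, j.2) : Idx Y) ≠ starIdx i := fun h => hj (by
      rw [← starIdx_starIdx i, ← h]
      simp [starIdx])
    simp [this]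

lemma integral_mulFin_injective {F G : Dist Y}
    (h : ∀ f, IsFin f → integral q (mulFin q F f) = integral q (mulFin q G f)) : F = G := by
  classical
  ext i
  have h1 : (1 : ℂ) - cq q ^ 2 ≠ 0 := by
    have : (q : ℝ) ^ 2 < 1 := pow_lt_one₀ q.2.1.le q.2.2 two_ne_zero
    rw [sub_ne_zero, cq]
    exact_mod_cast this.ne'
  have h2 := h (Pi.single (starIdx i) 1)
    ((Set.finite_singleton (starIdx i)).subset Pi.support_single_subset)
  rw [integral_mulFin_single, integral_mulFin_single] at h2
  exact mul_left_cancel₀ (pairWeight_ne_zero q i.1 i.2.2)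
    (mul_right_cancel₀ (zpow_ne_zero _ (cq_ne_zero q)) (mul_left_cancel₀ h1 h2))

lemma IsSharp.eq_sharp {Y₁ Y₂ : Space} {s : Dist2 Y₁ Y₂ →ₛₗ[starRingEnd ℂ] Dist2 Y₁ Y₂}
    (hs : IsSharp q s) : s = sharp q Y₁ Y₂ := by
  ext K i : 2
  refine integral_mulFin_injective q fun f hf => ?_
  exact congrFun ((hs K f hf).trans (isSharp_sharp q Y₁ Y₂ K f hf).symm) i

/-! ### Values of `#` on the generating kernels. -/

lemma emb_one (Y : Space) : emb q Y 1 = oneDist Y := by simp [emb]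

lemma emb2_neg (Y₁ Y₂ : Space) (p : Pol2 q Y₁ Y₂) : emb2 q Y₁ Y₂ (-p) = -emb2 q Y₁ Y₂ p :=
  map_neg (emb2 q Y₁ Y₂) p

lemma emb2_t (Y₁ Y₂ : Space) (g : Gen) (i : Idx Y₁) (j : Idx Y₂) :
    emb2 q Y₁ Y₂ (t q Y₁ Y₂ g) i j = emb q Y₁ (gen q Y₁ g) i * oneDist Y₂ j := by
  simp [emb2, t, emb_one, extProd]

lemma emb2_τ (Y₁ Y₂ : Space) (g : Gen) (i : Idx Y₁) (j : Idx Y₂) :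
    emb2 q Y₁ Y₂ (τ q Y₁ Y₂ g) i j = oneDist Y₁ i * emb q Y₂ (gen q Y₂ g) j := by
  simp [emb2, τ, emb_one, extProd]

/-- The second tensor factor is `1`, supported where `a = 0`, so the twist `q^(2a)` is invisible. -/
lemma sharp_t (Y₁ Y₂ : Space) (g : Gen) (i : Idx Y₁) (j : Idx Y₂) :
    sharp q Y₁ Y₂ (emb2 q Y₁ Y₂ (t q Y₁ Y₂ g)) i j =
      conjDist (emb q Y₁ (gen q Y₁ g)) i * oneDist Y₂ j := by
  obtain ⟨⟨a, b⟩, m⟩ := j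
  rw [sharp_apply, emb2_t, map_mul, ← conjDist_apply]
  by_cases h : a = 0 ∧ b = 0
  · simp [oneDist, starIdx, h]
  · simp [oneDist, starIdx, h]

/-- The twist now acts on the nontrivial tensor factor and survives. -/
lemma sharp_τ (Y₁ Y₂ : Space) (g : Gen) (i : Idx Y₁) (j : Idx Y₂) :
    sharp q Y₁ Y₂ (emb2 q Y₁ Y₂ (τ q Y₁ Y₂ g)) i j =
      oneDist Y₁ i * (cq q ^ (2 * j.1.1) * conjDist (emb q Y₂ (gen q Y₂ g)) j) := by
  obtain ⟨⟨a, b⟩, m⟩ := i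
  rw [sharp_apply, emb2_τ, map_mul, ← conjDist_apply _ j, mul_left_comm]
  by_cases h : a = 0 ∧ b = 0
  · simp [oneDist, starIdx, h]
  · simp [oneDist, starIdx, h]

lemma conjDist_t21 (Y : Space) :
    conjDist (emb q Y (gen q Y .t21)) = -(cq q)⁻¹ • emb q Y (gen q Y .t12) := by
  rw [emb_t21, emb_t12]
  ext ⟨⟨a, b⟩, m⟩
  by_cases h : a = 0 ∧ b = 1
  · simp [conjDist, h, conj_cq]
  · simp [conjDist, h]

end QKernel

end

open QKernel in
theorem proposition6p3 (q : Set.Ioo (0 : ℝ) 1) (Y₁ Y₂ : Space) :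
    (∃! s : Dist2 Y₁ Y₂ →ₛₗ[starRingEnd ℂ] Dist2 Y₁ Y₂, IsSharp q s) ∧
    ∀ s : Dist2 Y₁ Y₂ →ₛₗ[starRingEnd ℂ] Dist2 Y₁ Y₂, IsSharp q s →
      s (emb2 q Y₁ Y₂ (t q Y₁ Y₂ .t11)) = emb2 q Y₁ Y₂ (-t q Y₁ Y₂ .t22) ∧
      s (emb2 q Y₁ Y₂ (t q Y₁ Y₂ .t21)) = emb2 q Y₁ Y₂ (-(cq q)⁻¹ • t q Y₁ Y₂ .t12) ∧
      s (emb2 q Y₁ Y₂ (τ q Y₁ Y₂ .t11)) = emb2 q Y₁ Y₂ (-(cq q ^ 2)⁻¹ • τ q Y₁ Y₂ .t22) ∧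
      s (emb2 q Y₁ Y₂ (τ q Y₁ Y₂ .t21)) = emb2 q Y₁ Y₂ (-(cq q)⁻¹ • τ q Y₁ Y₂ .t12) := by
  refine ⟨⟨sharp q Y₁ Y₂, isSharp_sharp q Y₁ Y₂, fun s hs => IsSharp.eq_sharp q hs⟩, ?_⟩
  intro s hs
  obtain rfl := IsSharp.eq_sharp q hs
  refine ⟨?_, ?_, ?_, ?_⟩ <;> ext i j
  · rw [sharp_t, conjDist_emb_t11, emb2_neg, Pi.neg_apply, Pi.neg_apply, emb2_t, t11s,
      map_neg, Pi.neg_apply, neg_mul]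
  · rw [sharp_t, conjDist_t21, map_smul, Pi.smul_apply, Pi.smul_apply, Pi.smul_apply, emb2_t,
      smul_mul_assoc]
  · rw [sharp_τ, conjDist_emb_t11, map_smul, Pi.smul_apply, Pi.smul_apply, emb2_τ, t11s, map_neg,
      Pi.neg_apply, emb_t22]
    -- The series of `t₂₂` lives only in bidegree `(-1, 0)`, where the twist equals `q^(-2)`.
    by_cases h : j.1 = (-1, 0)
    · simp [h, zpow_neg]
      ring
    · simp [h]
  · rw [sharp_τ, conjDist_t21, map_smul, Pi.smul_apply, Pi.smul_apply, Pi.smul_apply, emb2_τ,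
      emb_t12]
    -- The series of `t₁₂` has `a = 0`, so the twist is `1`.
    by_cases h : j.1 = (0, 1)
    · simp [h]
      ring
    · simp [h]
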